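/- Consider the repeated $K$-unit uniform-price auction with the Last-Accepted-Bid (LAB) rule. Let $B=\{b\in[0,1]^K : b_1\ge b_2\ge\dots\ge b_K\}$. When the learner bids $b\in B$ and the adversary bids $\beta\in B$, the price $p(b,\beta)$ is the $K$-th highest of the $2K$ submitted bids (counted with multiplicity), the learner's allocation is $x(b,\beta)=\#\{k : b_k\ge p(b,\beta)\}$, and a learner with valuation $v\in[0,1]^K$ obtains the utility $u(b,\beta)=\sum_{l=1}^{x(b,\beta)}\bigl(v_l-p(b,\beta)\bigr)$. In every round $t=1,\dots,T$ the learner chooses a bid profile $b^t\in B$, possibly at random, as a measurable function of its internal randomness and of the bandit feedback of the earlier rounds; the bandit feedback of round $t$ reveals the allocation $x(b^t,\beta^t)$, and the price $p(b^t,\beta^t)$ only if $x(b^t,\beta^t)>0$. For a sequence $\beta=(\beta^t)_{t\le T}$ of adversary bids the regret is $$R_T=\sup_{b\in B}\sum_{t=1}^T u(b,\beta^t)-\mathbb E\Bigl[\sum_{t=1}^T u(b^t,\beta^t)\Bigr],$$ where the expectation is over the internal randomness of the learner. **Lemma.** Any online learning procedure must incur $\Omega(T^{2/3})$ regret in the multi-unit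 uniform-price auction with the LAB rule under bandit feedback. Precisely: there is an absolute constant $c>0$ such that for every $K\ge1$ there is a valuation $v\in[0,1]^K$ with $v_1\ge\dots\ge v_K$ such that for every horizon $T\ge1$ and every randomized online learning procedure with bandit feedback (which may depend on $K$, $v$ and $T$) there is a fixed sequence $\beta^1,\dots,\beta^T\in B$ of adversary bids with $$R_T\ge c\,T^{2/3}.$$ -/

import Mathlib

open MeasureTheory

noncomputable section

namespace UniformAuction

/-- The action space: bid profiles `1 ≥ b 0 ≥ b 1 ≥ ⋯ ≥ b (K - 1) ≥ 0`. -/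
def bidSpace (K : ℕ) : Set (Fin K → ℝ) :=
  {b | Antitone b ∧ ∀ k, b k ∈ Set.Icc (0 : ℝ) 1}

/-- The Last-Accepted-Bid price: the `K`-th highest (with multiplicity) of the `2 * K` bids.
`f ∘ Tuple.sort f` lists the bids in increasing order, its last entry is the highest bid, and
`Fin.rev` of position `K - 1` (counting from `0`) is the position of the `K`-th highest one. -/
def price {K : ℕ} [NeZero K] (b β : Fin K → ℝ) : ℝ :=
  let bids : Fin (K + K) → ℝ := Fin.append b β
  bids (Tuple.sort bids (Fin.rev ⟨K - 1, by have := NeZero.pos K; omega⟩))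

/-- The number of items that the learner wins: the number of their bids that are at least the
price. -/
def allocation {K : ℕ} [NeZero K] (b β : Fin K → ℝ) : ℕ :=
  Nat.card {k : Fin K // price b β ≤ b k}

/-- The quasi-linear utility of the learner with valuation `v`: the sum of `v l - price` over the
first `allocation b β` indices `l`. -/
def utility {K : ℕ} [NeZero K] (v b β : Fin K → ℝ) : ℝ :=
  ∑ l : Fin K, if (l : ℕ) < allocation b β then v l - price b β else 0

/-- Bandit feedback: the allocation is revealed, and the price is revealed only if the allocation
is positive (the second component is the constant `0` otherwise). -/
def banditFeedback {K : ℕ} [NeZero K] (b β : Fin K → ℝ) : ℕ × ℝ :=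
  (allocation b β, if 0 < allocation b β then price b β else 0)

/-- A randomized online learning procedure under bandit feedback, with internal randomness
`ω : Ω`: the bid profile of round `t` (rounds are numbered from `0`) is a measurable function of
`ω` and of the feedback received in the rounds before `t`. The learner's own earlier bids are
themselves determined by `ω` and the earlier feedback. -/
structure Procedure (K : ℕ) (Ω : Type*) [MeasurableSpace Ω] where
  bid : (t : ℕ) → Ω → (Fin t → ℕ × ℝ) → Fin K → ℝ
  bid_mem : ∀ t ω h, bid t ω h ∈ bidSpace K
  measurable_bid : ∀ t, Measurable fun z : Ω × (Fin t → ℕ × ℝ) => bid t z.1 z.2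

/-- The feedback received in the rounds before `t`, against the adversary's bids `β`. -/
def Procedure.history {K : ℕ} [NeZero K] {Ω : Type*} [MeasurableSpace Ω] (A : Procedure K Ω)
    (β : ℕ → Fin K → ℝ) (ω : Ω) : (t : ℕ) → Fin t → ℕ × ℝ
  | 0 => Fin.elim0
  | t + 1 => Fin.snoc (α := fun _ => ℕ × ℝ) (A.history β ω t)
      (banditFeedback (A.bid t ω (A.history β ω t)) (β t))

/-- The bid profile that the procedure plays in round `t`, against the adversary's bids `β`. -/
def Procedure.play {K : ℕ} [NeZero K] {Ω : Type*} [MeasurableSpace Ω] (A : Procedure K Ω)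
    (β : ℕ → Fin K → ℝ) (ω : Ω) (t : ℕ) : Fin K → ℝ :=
  A.bid t ω (A.history β ω t)

/-- The regret over `T` rounds against the best fixed bid profile, where `P` is the law of the
internal randomness of the procedure. -/
def Procedure.regret {K : ℕ} [NeZero K] {Ω : Type*} [MeasurableSpace Ω] (A : Procedure K Ω)
    (P : Measure Ω) (v : Fin K → ℝ) (β : ℕ → Fin K → ℝ) (T : ℕ) : ℝ :=
  (⨆ b : bidSpace K, ∑ t ∈ Finset.range T, utility v b (β t))
    - ∫ ω, ∑ t ∈ Finset.range T, utility v (A.play β ω t) (β t) ∂P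

end UniformAuction

end

/-! With values `(1, 0, …, 0)` and an adversary bidding `1` on all units but one and `z` on the
last, the price is `max (b 0) z`. The game becomes a first-price auction for one unit, in which the
feedback carries only the win/loss bit: a winner is told just its own top bid and the ties with it.
The lower bound is then a needle-in-a-haystack argument.

Draw `z` from a distribution for which the `N` grid bids all earn exactly `1 / 2` and no bid earns
more. Perturbation `i` moves one atom of mass `ε = 1 / (4 * N)` down by one grid point. This raises
the winning probability by `ε` in the `i`-th cell only, so the grid bid `i` gains order `1 / N` per
round, while bids outside that cell gain nothing. Each bid in the cell reveals `O(ε ^ 2)` of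
divergence and each bid outside it reveals none (`coinExp_visits_le`). Under the unperturbed law the
cells share `T` visits, so an average cell receives at most `T / N`; once `N ^ 3 ≥ 16 * T` this
cannot expose the perturbation. On average over `i`, at least half the rounds miss the good cell,
which costs `T / (12 * N)` (`sum_coinExp_revenue_le`). Taking `N` of order `T ^ (1 / 3)` gives the
rate.

For fixed internal randomness a procedure is a deterministic function of the win/loss bits, so the
stochastic part reduces to finite coin-flip expectations (`seqExp_outcomes`). -/

namespace UniformAuction

/-! ### Adaptive coin flips -/

/-- The expectation of `φ` over the outcomes of `t` successive coin flips, latest first, when the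
flip after the outcomes `h` succeeds with probability `p h`. -/
noncomputable def coinExp (p : List Bool → ℝ) : ℕ → (List Bool → ℝ) → ℝ
  | 0, φ => φ []
  | t + 1, φ => coinExp p t fun h => p h * φ (true :: h) + (1 - p h) * φ (false :: h)

lemma coinExp_add (p : List Bool → ℝ) (t : ℕ) (φ ψ : List Bool → ℝ) :
    coinExp p t (fun h => φ h + ψ h) = coinExp p t φ + coinExp p t ψ := by
  induction t generalizing φ ψ with
  | zero => rfl
  | succ t ih =>
    simp only [coinExp]
    rw [← ih]
    congr 1
    ext h
    ring

lemma coinExp_const_mul (p : List Bool → ℝ) (t : ℕ) (c : ℝ) (φ : List Bool → ℝ) :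
    coinExp p t (fun h => c * φ h) = c * coinExp p t φ := by
  induction t generalizing φ with
  | zero => rfl
  | succ t ih =>
    simp only [coinExp]
    rw [← ih]
    congr 1
    ext h
    ring

lemma coinExp_const (p : List Bool → ℝ) (t : ℕ) (c : ℝ) : coinExp p t (fun _ => c) = c := by
  induction t with
  | zero => rfl
  | succ t ih =>
    simp only [coinExp]
    refine Eq.trans ?_ ih
    congr 1
    ext h
    ring

lemma coinExp_sum {ι : Type*} (s : Finset ι) (p : List Bool → ℝ) (t : ℕ)
    (φ : ι → List Bool → ℝ) :
    coinExp p t (fun h => ∑ i ∈ s, φ i h) = ∑ i ∈ s, coinExp p t (φ i) := by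
  classical
  induction s using Finset.induction_on with
  | empty => simpa using coinExp_const p t 0
  | insert a s ha ih => simp only [Finset.sum_insert ha, coinExp_add, ih]

lemma coinExp_mono {p : List Bool → ℝ} (h0 : ∀ h, 0 ≤ p h) (h1 : ∀ h, p h ≤ 1) (t : ℕ)
    {φ ψ : List Bool → ℝ} (hle : ∀ h, h.length = t → φ h ≤ ψ h) :
    coinExp p t φ ≤ coinExp p t ψ := by
  induction t generalizing φ ψ with
  | zero => exact hle [] rfl
  | succ t ih =>
    refine ih fun h hh => ?_
    have a := hle (true :: h) (by simp [hh])
    have b := hle (false :: h) (by simp [hh])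
    have := sub_nonneg.2 (h1 h)
    have := h0 h
    gcongr

/-- The sum of `r` over the rounds of a play, where `r` is evaluated at the past of the round. -/
def pathSum (r : List Bool → ℝ) : List Bool → ℝ
  | [] => 0
  | _ :: h => pathSum r h + r h

lemma pathSum_nonneg {r : List Bool → ℝ} (hr : ∀ h, 0 ≤ r h) (h : List Bool) :
    0 ≤ pathSum r h := by
  induction h with
  | nil => exact le_rfl
  | cons b h ih => exact add_nonneg ih (hr h)

lemma pathSum_le_length {r : List Bool → ℝ} (hr : ∀ h, r h ≤ 1) (h : List Bool) :
    pathSum r h ≤ h.length := by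
  induction h with
  | nil => simp [pathSum]
  | cons b h ih => simpa [pathSum] using add_le_add ih (hr h)

lemma sum_pathSum {ι : Type*} (s : Finset ι) (r : ι → List Bool → ℝ) (h : List Bool) :
    ∑ i ∈ s, pathSum (r i) h = pathSum (fun h => ∑ i ∈ s, r i h) h := by
  induction h with
  | nil => simp [pathSum]
  | cons b h ih => simp [pathSum, Finset.sum_add_distrib, ih]

lemma coinExp_succ_pathSum (p r : List Bool → ℝ) (t : ℕ) :
    coinExp p (t + 1) (pathSum r) = coinExp p t (pathSum r) + coinExp p t r := by
  rw [← coinExp_add]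
  simp only [coinExp, pathSum]
  congr 1
  ext h
  ring

/-! ### Change of measure and divergence -/

open Classical in
/-- The likelihood ratio of the outcomes `h` between the coin whose success probability is raised
by `ε` on `I` and the original coin. -/
noncomputable def likelihood (p : List Bool → ℝ) (I : Set (List Bool)) (ε : ℝ) : List Bool → ℝ
  | [] => 1
  | true :: h => likelihood p I ε h * if h ∈ I then (p h + ε) / p h else 1
  | false :: h => likelihood p I ε h * if h ∈ I then (1 - p h - ε) / (1 - p h) else 1

section Likelihood

variable {p : List Bool → ℝ} {I : Set (List Bool)} {ε : ℝ}

lemma likelihood_pos (hε : 0 ≤ ε) (hI : ∀ h ∈ I, 1 / 2 ≤ p h ∧ p h + ε ≤ 3 / 4) (h : List Bool) :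
    0 < likelihood p I ε h := by
  induction h with
  | nil => exact one_pos
  | cons b h ih =>
    cases b <;> simp only [likelihood] <;> split_ifs with hh
    · obtain ⟨h1, h2⟩ := hI h hh
      exact mul_pos ih (div_pos (by linarith) (by linarith))
    · simpa using ih
    · obtain ⟨h1, h2⟩ := hI h hh
      exact mul_pos ih (div_pos (by linarith) (by linarith))
    · simpa using ih

lemma coinExp_likelihood_mul (hε : 0 ≤ ε) (hI : ∀ h ∈ I, 1 / 2 ≤ p h ∧ p h + ε ≤ 3 / 4) (t : ℕ)
    (φ : List Bool → ℝ) :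
    coinExp p t (fun h => likelihood p I ε h * φ h)
      = coinExp (fun h => p h + ε * I.indicator 1 h) t φ := by
  induction t generalizing φ with
  | zero => simp [coinExp, likelihood]
  | succ t ih =>
    simp only [coinExp]
    rw [← ih]
    congr 1
    ext h
    by_cases hh : h ∈ I
    · obtain ⟨h1, h2⟩ := hI h hh
      have a : p h ≠ 0 := by linarith
      have b : 1 - p h ≠ 0 := by linarith
      simp only [likelihood, hh, if_true, Set.indicator_of_mem, Pi.one_apply]
      field_simp
      ring
    · simp only [likelihood, hh, if_false, Set.indicator_of_notMem, not_false_eq_true]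
      ring

/-- By `log x ≥ 1 - 1 / x`, the Kullback–Leibler divergence is at most the chi-square term `ε ^ 2 /
((a + ε) * (1 - a - ε))`, whose denominator stays at least `1 / 8`. -/
lemma coin_divergence_le {a ε : ℝ} (hε : 0 ≤ ε) (h1 : 1 / 2 ≤ a) (h2 : a + ε ≤ 3 / 4) :
    -(a * Real.log ((a + ε) / a) + (1 - a) * Real.log ((1 - a - ε) / (1 - a))) ≤ 8 * ε ^ 2 := by
  have p1 : 0 < a := by linarith
  have p2 : 0 < a + ε := by linarith
  have p3 : 0 < 1 - a := by linarith
  have p4 : 0 < 1 - a - ε := by linarith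
  have l1 := Real.one_sub_inv_le_log_of_pos (div_pos p2 p1)
  have l2 := Real.one_sub_inv_le_log_of_pos (div_pos p4 p3)
  have m1 := mul_le_mul_of_nonneg_left l1 p1.le
  have m2 := mul_le_mul_of_nonneg_left l2 p3.le
  have key : -(a * (1 - ((a + ε) / a)⁻¹) + (1 - a) * (1 - ((1 - a - ε) / (1 - a))⁻¹))
      = ε ^ 2 / ((a + ε) * (1 - a - ε)) := by
    field_simp
    ring
  have : ε ^ 2 / ((a + ε) * (1 - a - ε)) ≤ 8 * ε ^ 2 := by
    rw [div_le_iff₀ (by positivity)]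
    have : 1 / 8 ≤ (a + ε) * (1 - a - ε) := by nlinarith
    nlinarith [sq_nonneg ε]
  linarith

/-- Chain rule: the divergence of the whole play is the sum of the one-step divergences, which
vanish outside `I`. -/
lemma coinExp_neg_log_likelihood_le (h0 : ∀ h, 0 ≤ p h) (h1 : ∀ h, p h ≤ 1) (hε : 0 ≤ ε)
    (hI : ∀ h ∈ I, 1 / 2 ≤ p h ∧ p h + ε ≤ 3 / 4) (t : ℕ) :
    coinExp p t (fun h => -Real.log (likelihood p I ε h))
      ≤ 8 * ε ^ 2 * coinExp p t (pathSum (I.indicator 1)) := by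
  induction t with
  | zero => simp [coinExp, likelihood, pathSum]
  | succ t ih =>
    rw [coinExp_succ_pathSum, mul_add, ← coinExp_const_mul p t _ (I.indicator 1)]
    refine le_trans ?_ (add_le_add_left ih _)
    rw [← coinExp_add]
    refine coinExp_mono h0 h1 t fun h _ => ?_
    have hL := (likelihood_pos hε hI h).ne'
    by_cases hh : h ∈ I
    · obtain ⟨b1, b2⟩ := hI h hh
      have := coin_divergence_le hε b1 b2
      simp only [likelihood, hh, if_true, Set.indicator_of_mem, Pi.one_apply]
      rw [Real.log_mul hL (div_pos (by linarith) (by linarith)).ne',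
        Real.log_mul hL (div_pos (by linarith) (by linarith)).ne']
      linarith
    · simp only [likelihood, hh, if_false, Set.indicator_of_notMem, not_false_eq_true, mul_one]
      linarith

/-- A substitute for Pinsker's inequality: the excess of the likelihood ratio is paid for by the
integrand of the divergence, up to a constant. The proof is the tangent line of `log` at `4 / 3`. -/
lemma sub_one_le_divergence {x : ℝ} (hx : 0 < x) :
    x - 1 ≤ 4 * (x - 1 - Real.log x) + 1 / 4 := by
  have h1 : Real.log (x * (3 / 4)) ≤ x * (3 / 4) - 1 :=
    Real.log_le_sub_one_of_pos (by positivity)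
  rw [Real.log_mul hx.ne' (by norm_num)] at h1
  have h2 : -(5 / 16 : ℝ) ≤ Real.log (3 / 4) := by
    rw [neg_le, ← Real.log_inv, Real.log_le_iff_le_exp (by norm_num)]
    have := Real.quadratic_le_exp_of_nonneg (show (0 : ℝ) ≤ 5 / 16 by norm_num)
    norm_num at this ⊢
    linarith
  linarith

/-- Raising the success probability by `ε` on `I` changes the expected number of visits to `I`
after `t` rounds by little, unless the original coin visits `I` about `1 / ε ^ 2` times. -/
lemma coinExp_visits_le (h0 : ∀ h, 0 ≤ p h) (h1 : ∀ h, p h ≤ 1) (hε : 0 ≤ ε)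
    (hI : ∀ h ∈ I, 1 / 2 ≤ p h ∧ p h + ε ≤ 3 / 4) (t : ℕ) :
    coinExp (fun h => p h + ε * I.indicator 1 h) t (pathSum (I.indicator 1))
      ≤ coinExp p t (pathSum (I.indicator 1))
        + t * (32 * ε ^ 2 * coinExp p t (pathSum (I.indicator 1)) + 1 / 4) := by
  have hE : coinExp p t (likelihood p I ε) = 1 := by
    have := coinExp_likelihood_mul hε hI t fun _ => 1
    simpa [coinExp_const] using this
  have hKL := coinExp_neg_log_likelihood_le h0 h1 hε hI t
  have hr0 : ∀ h, (0 : ℝ) ≤ I.indicator 1 h := Set.indicator_nonneg (by simp)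
  have hr1 : ∀ h, I.indicator 1 h ≤ (1 : ℝ) := fun h => Set.indicator_le_self' (by simp) h
  rw [← coinExp_likelihood_mul hε hI]
  have hb : coinExp p t (fun h => likelihood p I ε h * pathSum (I.indicator 1) h) ≤
      coinExp p t (fun h => pathSum (I.indicator 1) h +
        (4 * t * likelihood p I ε h + (4 * t * -Real.log (likelihood p I ε h)
          + (-(4 * t) + t * (1 / 4))))) := by
    refine coinExp_mono h0 h1 t fun h hh => ?_
    have hL := likelihood_pos hε hI h
    have a := sub_one_le_divergence hL
    have b := Real.log_le_sub_one_of_pos hL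
    have n0 := pathSum_nonneg hr0 h
    have n1 := pathSum_le_length hr1 h
    rw [hh] at n1
    -- The number of visits lies in `[0, t]`, so it can be replaced by `t` once the other factor is
    -- bounded by something nonnegative.
    have c : (likelihood p I ε h - 1) * pathSum (I.indicator 1) h
        ≤ (4 * (likelihood p I ε h - 1 - Real.log (likelihood p I ε h)) + 1 / 4) * t := by
      refine (mul_le_mul_of_nonneg_right a n0).trans (mul_le_mul_of_nonneg_left n1 ?_)
      linarith
    linarith
  refine hb.trans ?_
  rw [coinExp_add, coinExp_add, coinExp_add, coinExp_const_mul, coinExp_const_mul, coinExp_const,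
    hE]
  have := mul_le_mul_of_nonneg_left hKL (show (0 : ℝ) ≤ 4 * t by positivity)
  linarith

end Likelihood

/-! ### Reduction to a first-price auction -/

/-- The adversary's bid profile that leaves a single unit, for which it bids `z`. -/
def singleUnitBid (K : ℕ) (z : ℝ) : Fin K → ℝ := fun k => if (k : ℕ) + 1 < K then 1 else z

lemma singleUnitBid_mem {K : ℕ} {z : ℝ} (hz : z ∈ Set.Icc (0 : ℝ) 1) :
    singleUnitBid K z ∈ bidSpace K := by
  constructor
  · intro i j hij
    have : (i : ℕ) ≤ j := hij
    unfold singleUnitBid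
    split_ifs
    · exact le_rfl
    · omega
    · exact hz.2
    · exact le_rfl
  · intro k
    unfold singleUnitBid
    split_ifs
    · simp
    · exact hz

section Price

variable {K : ℕ} [NeZero K]

lemma le_price {b β : Fin K → ℝ} {y : ℝ} (s : Finset (Fin (K + K))) (hs : K ≤ s.card)
    (h : ∀ j ∈ s, y ≤ Fin.append b β j) : y ≤ price b β := by
  by_contra! hlt
  have hK := NeZero.pos K
  set i : Fin (K + K) := Fin.rev ⟨K - 1, by omega⟩ with hi
  have hiv : (i : ℕ) = K := by simp [hi, Fin.val_rev]; omega
  have hsub : s.map (Tuple.sort (Fin.append b β)).symm.toEmbedding ⊆ Finset.Ioi i := by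
    intro l hl
    rw [Finset.mem_map_equiv, Equiv.symm_symm] at hl
    rw [Finset.mem_Ioi]
    by_contra! hle
    exact absurd (h _ hl) (not_le.2 ((Tuple.monotone_sort (Fin.append b β) hle).trans_lt hlt))
  have := Finset.card_le_card hsub
  rw [Finset.card_map, Fin.card_Ioi, hiv] at this
  omega

lemma price_le {b β : Fin K → ℝ} {y : ℝ} (s : Finset (Fin (K + K))) (hs : s.card < K)
    (h : ∀ j, y < Fin.append b β j → j ∈ s) : price b β ≤ y := by
  by_contra! hlt
  have hK := NeZero.pos K
  set i : Fin (K + K) := Fin.rev ⟨K - 1, by omega⟩ with hi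
  have hiv : (i : ℕ) = K := by simp [hi, Fin.val_rev]; omega
  have hsub : Finset.Ici i ⊆ s.map (Tuple.sort (Fin.append b β)).symm.toEmbedding := by
    intro l hl
    rw [Finset.mem_map_equiv, Equiv.symm_symm]
    exact h _ (hlt.trans_le (Tuple.monotone_sort (Fin.append b β) (Finset.mem_Ici.1 hl)))
  have := Finset.card_le_card hsub
  rw [Finset.card_map, Fin.card_Ici, hiv] at this
  omega

lemma price_singleUnitBid {b : Fin K → ℝ} {z : ℝ} (hb : b ∈ bidSpace K)
    (hz : z ∈ Set.Icc (0 : ℝ) 1) : price b (singleUnitBid K z) = max (b 0) z := by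
  have hK := NeZero.pos K
  have hmax : max (b 0) z ≤ 1 := max_le (hb.2 0).2 hz.2
  apply le_antisymm
  · refine price_le ((Finset.univ.filter fun k : Fin K => (k : ℕ) + 1 < K).map
      (Fin.natAddEmb K)) ?_ ?_
    · rw [Finset.card_map]
      refine (Finset.card_lt_univ_of_notMem (x := (⟨K - 1, by omega⟩ : Fin K)) ?_).trans_eq
        (Fintype.card_fin K)
      simp
      omega
    · intro j
      refine Fin.addCases (fun k hk => ?_) (fun k hk => ?_) j
      · rw [Fin.append_left] at hk
        exact absurd (hb.1 (Fin.zero_le k)) (not_le.2 ((le_max_left _ _).trans_lt hk))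
      · rw [Fin.append_right] at hk
        have : (k : ℕ) + 1 < K := by
          by_contra hc
          rw [singleUnitBid, if_neg hc] at hk
          exact absurd hk (not_lt.2 (le_max_right _ _))
        simpa using this
  -- `K` bids that reach the maximum: the adversary's `K - 1` bids of `1`, and the larger of `z` and
  -- `b 0`.
  · obtain ⟨g, hg⟩ : ∃ g : Fin K → Fin (K + K), ∀ k, g k =
      if (k : ℕ) + 1 < K ∨ b 0 ≤ z then Fin.natAdd K k else Fin.castAdd K 0 := ⟨_, fun _ => rfl⟩
    have hinj : Function.Injective g := by
      intro k l hkl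
      rw [hg, hg] at hkl
      split_ifs at hkl with h1 h2 h2
      · simpa using hkl
      · have := congrArg Fin.val hkl
        simp only [Fin.val_natAdd, Fin.val_castAdd, Fin.val_zero] at this
        omega
      · have := congrArg Fin.val hkl
        simp only [Fin.val_natAdd, Fin.val_castAdd, Fin.val_zero] at this
        omega
      · ext
        omega
    refine le_price (Finset.univ.map ⟨g, hinj⟩) (by simp) ?_
    intro j hj
    simp only [Finset.mem_map, Finset.mem_univ, true_and, Function.Embedding.coeFn_mk] at hj
    obtain ⟨k, rfl⟩ := hj
    rw [hg]
    split_ifs with h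
    · rw [Fin.append_right, singleUnitBid]
      split_ifs with h'
      · exact hmax
      · exact max_le (h.resolve_left h') le_rfl
    · rw [Fin.append_left]
      push Not at h
      exact max_le le_rfl h.2.le

/-- The number of bids that tie with the highest one. -/
noncomputable def tieCount (b : Fin K → ℝ) : ℕ := Nat.card {k : Fin K // b 0 ≤ b k}

lemma tieCount_eq_sum (b : Fin K → ℝ) : tieCount b = ∑ k, if b 0 ≤ b k then 1 else 0 := by
  rw [tieCount, Nat.card_eq_fintype_card, Fintype.card_subtype, Finset.card_filter]

lemma tieCount_pos (b : Fin K → ℝ) : 0 < tieCount b := by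
  rw [tieCount, Nat.card_pos_iff]
  exact ⟨⟨⟨0, le_rfl⟩⟩, inferInstance⟩

lemma allocation_singleUnitBid {b : Fin K → ℝ} {z : ℝ} (hb : b ∈ bidSpace K)
    (hz : z ∈ Set.Icc (0 : ℝ) 1) :
    allocation b (singleUnitBid K z) = if z ≤ b 0 then tieCount b else 0 := by
  rw [allocation, price_singleUnitBid hb hz]
  split_ifs with h
  · rw [max_eq_left h, tieCount]
  · have : IsEmpty {k : Fin K // max (b 0) z ≤ b k} :=
      ⟨fun k => h ((le_max_right _ _).trans (k.2.trans (hb.1 (Fin.zero_le _))))⟩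
    exact Nat.card_of_isEmpty

/-- The bandit feedback to the bids `b` when the highest bid wins (`true`) or loses (`false`) the
single unit left. -/
noncomputable def singleUnitFeedback (win : Bool) (b : Fin K → ℝ) : ℕ × ℝ :=
  if win then (tieCount b, b 0) else (0, 0)

lemma banditFeedback_singleUnitBid {b : Fin K → ℝ} {z : ℝ} (hb : b ∈ bidSpace K)
    (hz : z ∈ Set.Icc (0 : ℝ) 1) :
    banditFeedback b (singleUnitBid K z) = singleUnitFeedback (decide (z ≤ b 0)) b := by
  rw [banditFeedback, price_singleUnitBid hb hz, allocation_singleUnitBid hb hz]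
  by_cases h : z ≤ b 0
  · simp [h, singleUnitFeedback, tieCount_pos]
  · simp [h, singleUnitFeedback]

lemma measurable_singleUnitFeedback (z : ℝ) :
    Measurable fun b : Fin K → ℝ => singleUnitFeedback (decide (z ≤ b 0)) b := by
  have h : (fun b : Fin K → ℝ => singleUnitFeedback (decide (z ≤ b 0)) b)
      = fun b => if z ≤ b 0 then (∑ k, if b 0 ≤ b k then 1 else 0, b 0) else (0, 0) := by
    ext1 b
    simp [singleUnitFeedback, tieCount_eq_sum]
  rw [h]
  refine Measurable.ite (measurableSet_le measurable_const (measurable_pi_apply 0))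
    (Measurable.prodMk (Finset.measurable_sum _ fun k _ => ?_) (measurable_pi_apply 0))
    measurable_const
  exact Measurable.ite (measurableSet_le (measurable_pi_apply 0) (measurable_pi_apply k))
    measurable_const measurable_const

/-- The profile with first entry `x` and all other entries `0`. -/
def soleBid (K : ℕ) [NeZero K] (x : ℝ) : Fin K → ℝ := fun k => if k = 0 then x else 0

/-- The revenue of the bid `x` in a first-price auction against the bid `z`, for value `1`. -/
noncomputable def firstPriceUtility (x z : ℝ) : ℝ := if z ≤ x then 1 - x else 0

lemma firstPriceUtility_nonneg {x : ℝ} (hx : x ≤ 1) (z : ℝ) : 0 ≤ firstPriceUtility x z := by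
  rw [firstPriceUtility]
  split_ifs <;> linarith

lemma firstPriceUtility_le_one {x : ℝ} (hx : 0 ≤ x) (z : ℝ) : firstPriceUtility x z ≤ 1 := by
  rw [firstPriceUtility]
  split_ifs <;> linarith

/-- Further units won through ties have value `0` and a nonnegative price, so they cannot help. -/
lemma utility_le_firstPriceUtility {b : Fin K → ℝ} {z : ℝ} (hb : b ∈ bidSpace K)
    (hz : z ∈ Set.Icc (0 : ℝ) 1) :
    utility (soleBid K 1) b (singleUnitBid K z) ≤ firstPriceUtility (b 0) z := by
  rw [utility, price_singleUnitBid hb hz, allocation_singleUnitBid hb hz, firstPriceUtility]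
  split_ifs with h
  · rw [max_eq_left h]
    have : ∀ l : Fin K, (if (l : ℕ) < tieCount b then soleBid K 1 l - b 0 else 0)
        ≤ if l = 0 then 1 - b 0 else 0 := by
      intro l
      have := (hb.2 0).1
      rcases eq_or_ne l 0 with rfl | hl
      · simp [soleBid, tieCount_pos]
      · simp only [soleBid, hl, if_false]
        split_ifs <;> linarith
    refine (Finset.sum_le_sum fun l _ => this l).trans ?_
    simp
  · simp

lemma soleBid_mem {x : ℝ} (hx : x ∈ Set.Icc (0 : ℝ) 1) : soleBid K x ∈ bidSpace K := by
  constructor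
  · intro i j hij
    unfold soleBid
    split_ifs with h1 h2 h2
    · exact le_rfl
    · exact absurd (le_antisymm (hij.trans_eq h1) (Fin.zero_le i)) h2
    · exact hx.1
    · exact le_rfl
  · intro k
    unfold soleBid
    split_ifs
    · exact hx
    · simp

lemma firstPriceUtility_le_utility_soleBid {x z : ℝ} (hx : x ∈ Set.Icc (0 : ℝ) 1)
    (hz : z ∈ Set.Icc (0 : ℝ) 1) :
    firstPriceUtility x z ≤ utility (soleBid K 1) (soleBid K x) (singleUnitBid K z) := by
  have hb := soleBid_mem (K := K) hx
  have h0 : soleBid K x 0 = x := by simp [soleBid]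
  rw [utility, price_singleUnitBid hb hz, allocation_singleUnitBid hb hz, firstPriceUtility, h0]
  split_ifs with h
  · rw [max_eq_left h]
    have : ∀ l : Fin K, (if l = 0 then 1 - x else 0)
        ≤ if (l : ℕ) < tieCount (soleBid K x) then soleBid K 1 l - x else 0 := by
      intro l
      rcases eq_or_ne l 0 with rfl | hl
      · simp [soleBid, tieCount_pos]
      · simp only [soleBid, hl, if_false]
        split_ifs with hlt
        -- At `x = 0` every bid ties and further units are won, but the price is `0`; for `x > 0`
        -- only one unit is won.
        · rcases hx.1.eq_or_lt with rfl | hpos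
          · simp
          · have h1 : tieCount (soleBid K x) = 1 := by
              rw [tieCount_eq_sum, Finset.sum_eq_single 0]
              · simp
              · intro k _ hk
                simp [soleBid, hk, hpos]
              · simp
            rw [h1] at hlt
            exact absurd (Fin.ext (by simpa using hlt)) hl
        · exact le_rfl
    refine le_trans ?_ (Finset.sum_le_sum fun l _ => this l)
    simp
  · simp

end Price

/-! ### Procedures as strategies on win/loss outcomes -/

section Simulation

variable {K : ℕ} [NeZero K] {Ω : Type*} [MeasurableSpace Ω]

/-- The number of rounds and the feedback history that result from the win/loss outcomes `h`
(latest first) in the auction for a single unit. -/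
noncomputable def Procedure.simulate (A : Procedure K Ω) (ω : Ω) : List Bool → Σ t, Fin t → ℕ × ℝ
  | [] => ⟨0, Fin.elim0⟩
  | w :: h => ⟨(A.simulate ω h).1 + 1, Fin.snoc (α := fun _ => ℕ × ℝ) (A.simulate ω h).2
      (singleUnitFeedback w (A.bid _ ω (A.simulate ω h).2))⟩

/-- The highest bid that follows the win/loss outcomes `h`. -/
noncomputable def Procedure.topBid (A : Procedure K Ω) (ω : Ω) (h : List Bool) : ℝ :=
  A.bid _ ω (A.simulate ω h).2 0

lemma Procedure.topBid_mem (A : Procedure K Ω) (ω : Ω) (h : List Bool) :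
    A.topBid ω h ∈ Set.Icc (0 : ℝ) 1 := (A.bid_mem _ _ _).2 0

/-- The outcomes, latest first, of the first `t` first-price auctions of the bidding strategy `f`
against the bids `z`. -/
noncomputable def outcomes (f : List Bool → ℝ) (z : ℕ → ℝ) : ℕ → List Bool
  | 0 => []
  | t + 1 => decide (z t ≤ f (outcomes f z t)) :: outcomes f z t

variable {A : Procedure K Ω} {z : ℕ → ℝ}

/-- The feedback is a function of the win/loss bit and the procedure's own bids, so the bits and `ω`
determine the whole history. -/
lemma simulate_outcomes (hz : ∀ t, z t ∈ Set.Icc (0 : ℝ) 1) (ω : Ω) (t : ℕ) :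
    A.simulate ω (outcomes (A.topBid ω) z t)
      = ⟨t, A.history (fun t => singleUnitBid K (z t)) ω t⟩ := by
  induction t with
  | zero => rfl
  | succ t ih =>
    rw [outcomes, Procedure.simulate, Procedure.history, banditFeedback_singleUnitBid
      (A.bid_mem _ _ _) (hz t), Procedure.topBid, ih]

lemma topBid_outcomes (hz : ∀ t, z t ∈ Set.Icc (0 : ℝ) 1) (ω : Ω) (t : ℕ) :
    A.topBid ω (outcomes (A.topBid ω) z t)
      = A.play (fun t => singleUnitBid K (z t)) ω t 0 := by
  rw [Procedure.topBid, simulate_outcomes hz, Procedure.play]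

lemma measurable_play (hz : ∀ t, z t ∈ Set.Icc (0 : ℝ) 1) (t : ℕ) :
    Measurable fun ω => A.play (fun t => singleUnitBid K (z t)) ω t := by
  suffices h : Measurable fun ω => A.history (fun t => singleUnitBid K (z t)) ω t from
    (A.measurable_bid t).comp (measurable_id.prodMk h)
  induction t with
  | zero => exact measurable_pi_iff.2 fun i => i.elim0
  | succ t ih =>
    have hplay := (A.measurable_bid t).comp (measurable_id.prodMk ih)
    refine measurable_pi_iff.2 fun i => ?_
    simp only [Procedure.history]
    refine Fin.lastCases ?_ (fun j => ?_) i
    · simp only [Fin.snoc_last, banditFeedback_singleUnitBid (A.bid_mem _ _ _) (hz t)]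
      exact (measurable_singleUnitFeedback (z t)).comp hplay
    · simp only [Fin.snoc_castSucc]
      exact (measurable_pi_apply j).comp ih

/-- The total revenue of the bidding strategy `f` over the rounds with outcomes `h`. -/
def revenue (f : List Bool → ℝ) : List Bool → ℝ
  | [] => 0
  | true :: h => revenue f h + (1 - f h)
  | false :: h => revenue f h

lemma revenue_outcomes (hz : ∀ t, z t ∈ Set.Icc (0 : ℝ) 1) (ω : Ω) (T : ℕ) :
    revenue (A.topBid ω) (outcomes (A.topBid ω) z T) = ∑ t ∈ Finset.range T,
      firstPriceUtility (A.play (fun t => singleUnitBid K (z t)) ω t 0) (z t) := by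
  induction T with
  | zero => rfl
  | succ T ih =>
    rw [Finset.sum_range_succ, ← ih, outcomes, ← topBid_outcomes hz, firstPriceUtility]
    split_ifs with h <;> simp [h, revenue]

lemma integrable_revenue (P : Measure Ω) [IsProbabilityMeasure P]
    (hz : ∀ t, z t ∈ Set.Icc (0 : ℝ) 1) (T : ℕ) :
    Integrable (fun ω => revenue (A.topBid ω) (outcomes (A.topBid ω) z T)) P := by
  simp only [revenue_outcomes hz]
  refine integrable_finsetSum _ fun t _ => ?_
  have hm := (measurable_pi_apply 0).comp (measurable_play (A := A) hz t)
  refine Integrable.of_mem_Icc 0 1 (Measurable.ite (measurableSet_le measurable_const hm)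
    (measurable_const.sub hm) measurable_const).aemeasurable (Filter.Eventually.of_forall ?_)
  intro ω
  have := (A.bid_mem t ω (A.history (fun t => singleUnitBid K (z t)) ω t)).2 0
  exact ⟨firstPriceUtility_nonneg this.2 _, firstPriceUtility_le_one this.1 _⟩

lemma integrable_utility_play (P : Measure Ω) [IsProbabilityMeasure P]
    (hz : ∀ t, z t ∈ Set.Icc (0 : ℝ) 1) (t : ℕ) :
    Integrable (fun ω => utility (soleBid K 1)
      (A.play (fun t => singleUnitBid K (z t)) ω t) (singleUnitBid K (z t))) P := by
  have hb := fun ω => A.bid_mem t ω (A.history (fun t => singleUnitBid K (z t)) ω t)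
  have hplay := measurable_play (A := A) hz t
  have h0 := (measurable_pi_apply 0).comp hplay
  have halloc : Measurable fun ω => allocation (A.play (fun t => singleUnitBid K (z t)) ω t)
      (singleUnitBid K (z t)) := by
    simp only [Procedure.play, allocation_singleUnitBid (hb _) (hz t), tieCount_eq_sum]
    refine Measurable.ite (measurableSet_le measurable_const h0)
      (Finset.measurable_sum _ fun k _ => ?_) measurable_const
    exact Measurable.ite (measurableSet_le h0 ((measurable_pi_apply k).comp hplay))
      measurable_const measurable_const
  simp only [utility]
  refine integrable_finsetSum _ fun l _ => ?_
  have hprice : ∀ ω, price (A.play (fun t => singleUnitBid K (z t)) ω t) (singleUnitBid K (z t))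
      = max (A.play (fun t => singleUnitBid K (z t)) ω t 0) (z t) :=
    fun ω => price_singleUnitBid (hb ω) (hz t)
  simp only [hprice]
  refine Integrable.of_mem_Icc (-1) 1 (Measurable.ite (measurableSet_lt measurable_const halloc)
    (measurable_const.sub (h0.max measurable_const)) measurable_const).aemeasurable
    (Filter.Eventually.of_forall fun ω => ?_)
  have hv := (soleBid_mem (K := K) (x := 1) (by simp)).2 l
  have h1 : max (A.play (fun t => singleUnitBid K (z t)) ω t 0) (z t) ≤ 1 :=
    max_le ((hb ω).2 0).2 (hz t).2
  have h2 : 0 ≤ max (A.play (fun t => singleUnitBid K (z t)) ω t 0) (z t) :=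
    le_max_of_le_right (hz t).1
  split_ifs
  · exact ⟨by linarith [hv.1], by linarith [hv.2]⟩
  · norm_num

/-- The comparator loses nothing by bidding on one unit only, and the procedure earns at most the
first-price revenue of its top bid. -/
lemma regret_ge (P : Measure Ω) [IsProbabilityMeasure P]
    (hz : ∀ t, z t ∈ Set.Icc (0 : ℝ) 1) (T : ℕ) {x : ℝ} (hx : x ∈ Set.Icc (0 : ℝ) 1) :
    ∑ t ∈ Finset.range T, firstPriceUtility x (z t)
        - ∫ ω, revenue (A.topBid ω) (outcomes (A.topBid ω) z T) ∂P
      ≤ A.regret P (soleBid K 1) (fun t => singleUnitBid K (z t)) T := by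
  have hle : ∀ b ∈ bidSpace K, ∀ t,
      utility (soleBid K 1) b (singleUnitBid K (z t)) ≤ firstPriceUtility (b 0) (z t) :=
    fun b hb t => utility_le_firstPriceUtility hb (hz t)
  refine sub_le_sub ?_ ?_
  · refine le_trans (Finset.sum_le_sum fun t _ =>
      firstPriceUtility_le_utility_soleBid (K := K) hx (hz t)) ?_
    refine le_ciSup (f := fun b : bidSpace K => ∑ t ∈ Finset.range T,
      utility (soleBid K 1) b (singleUnitBid K (z t))) ?_ ⟨_, soleBid_mem hx⟩
    -- Boundedness, without which the real supremum would be a junk value.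
    refine ⟨∑ t ∈ Finset.range T, 1, ?_⟩
    rintro _ ⟨b, rfl⟩
    exact Finset.sum_le_sum fun t _ =>
      (hle b b.2 t).trans (firstPriceUtility_le_one (b.2.2 0).1 _)
  · have hpt : ∀ ω, ∑ t ∈ Finset.range T, utility (soleBid K 1)
        (A.play (fun t => singleUnitBid K (z t)) ω t) (singleUnitBid K (z t))
          ≤ revenue (A.topBid ω) (outcomes (A.topBid ω) z T) := fun ω => by
      rw [revenue_outcomes hz]
      exact Finset.sum_le_sum fun t _ => hle _ (A.bid_mem _ _ _) t
    exact integral_mono (integrable_finsetSum _ fun t _ => integrable_utility_play P hz t)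
      (integrable_revenue P hz T) hpt

end Simulation

/-! ### Independent random adversary bids -/

section SeqExp

variable {ι : Type*} [Fintype ι] [Inhabited ι]

/-- The expectation of `φ` over a sequence whose first `t` entries are drawn independently with
the weights `w`, the other entries being the default. -/
noncomputable def seqExp (w : ι → ℝ) : ℕ → ((ℕ → ι) → ℝ) → ℝ
  | 0, φ => φ default
  | t + 1, φ => seqExp w t fun s => ∑ a, w a * φ (Function.update s t a)

lemma seqExp_sub (w : ι → ℝ) (t : ℕ) (φ ψ : (ℕ → ι) → ℝ) :
    seqExp w t (fun s => φ s - ψ s) = seqExp w t φ - seqExp w t ψ := by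
  induction t generalizing φ ψ with
  | zero => rfl
  | succ t ih => simp only [seqExp, ← ih, mul_sub, Finset.sum_sub_distrib]

lemma seqExp_add_const {w : ι → ℝ} (hw : ∑ a, w a = 1) (t : ℕ) (φ : (ℕ → ι) → ℝ) (c : ℝ) :
    seqExp w t (fun s => φ s + c) = seqExp w t φ + c := by
  induction t generalizing φ with
  | zero => rfl
  | succ t ih => simp only [seqExp, ← ih, mul_add, Finset.sum_add_distrib, ← Finset.sum_mul, hw,
      one_mul]

lemma exists_seqExp_le {w : ι → ℝ} (hpos : ∀ a, 0 < w a) (hw : ∑ a, w a = 1) (t : ℕ)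
    (φ : (ℕ → ι) → ℝ) : ∃ s, seqExp w t φ ≤ φ s := by
  induction t generalizing φ with
  | zero => exact ⟨default, le_rfl⟩
  | succ t ih =>
    obtain ⟨s, hs⟩ := ih fun s => ∑ a, w a * φ (Function.update s t a)
    obtain ⟨a, -, ha⟩ := Finset.exists_le_of_sum_le (s := Finset.univ) Finset.univ_nonempty
      (show ∑ a, w a * seqExp w (t + 1) φ ≤ ∑ a, w a * φ (Function.update s t a) by
        rwa [← Finset.sum_mul, hw, one_mul])
    exact ⟨_, le_of_mul_le_mul_left ha (hpos a)⟩

lemma seqExp_sum_range {w : ι → ℝ} (hw : ∑ a, w a = 1) (g : ι → ℝ) (t : ℕ) :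
    seqExp w t (fun s => ∑ k ∈ Finset.range t, g (s k)) = t * ∑ a, w a * g a := by
  induction t with
  | zero => simp [seqExp]
  | succ t ih =>
    have h : ∀ (s : ℕ → ι) (a : ι), ∑ k ∈ Finset.range (t + 1), g (Function.update s t a k)
        = ∑ k ∈ Finset.range t, g (s k) + g a := fun s a => by
      rw [Finset.sum_range_succ, Function.update_self]
      congr 1
      refine Finset.sum_congr rfl fun k hk => ?_
      rw [Function.update_of_ne (Finset.mem_range.1 hk).ne]
    simp only [seqExp, h, mul_add, Finset.sum_add_distrib, ← Finset.sum_mul, hw, one_mul]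
    rw [seqExp_add_const hw, ih]
    push_cast
    ring

lemma integral_seqExp {Ω : Type*} [MeasurableSpace Ω] {P : Measure Ω} (w : ι → ℝ) (t : ℕ)
    {G : Ω → (ℕ → ι) → ℝ} (hG : ∀ s, Integrable (fun ω => G ω s) P) :
    Integrable (fun ω => seqExp w t (G ω)) P ∧
      ∫ ω, seqExp w t (G ω) ∂P = seqExp w t fun s => ∫ ω, G ω s ∂P := by
  induction t generalizing G with
  | zero => exact ⟨hG default, rfl⟩
  | succ t ih =>
    have hi : ∀ s a, Integrable (fun ω => w a * G ω (Function.update s t a)) P :=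
      fun s a => (hG _).const_mul _
    obtain ⟨h1, h2⟩ := ih (G := fun ω s => ∑ a, w a * G ω (Function.update s t a))
      fun s => integrable_finsetSum _ fun a _ => hi s a
    refine ⟨h1, h2.trans ?_⟩
    simp only [seqExp]
    congr 1
    ext s
    rw [integral_finsetSum _ fun a _ => hi s a]
    exact Finset.sum_congr rfl fun a _ => integral_const_mul _ _

lemma outcomes_congr (f : List Bool → ℝ) {z z' : ℕ → ℝ} {t : ℕ} (h : ∀ k < t, z k = z' k) :
    outcomes f z t = outcomes f z' t := by
  induction t with
  | zero => rfl
  | succ t ih => rw [outcomes, outcomes, ih fun k hk => h k (hk.trans t.lt_succ_self),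
      h t t.lt_succ_self]

/-- The outcomes of a strategy against independent random bids are those of coin flips. -/
lemma seqExp_outcomes {w : ι → ℝ} (hw : ∑ a, w a = 1) (ζ : ι → ℝ) (f : List Bool → ℝ) (t : ℕ)
    (ψ : List Bool → ℝ) :
    seqExp w t (fun s => ψ (outcomes f (fun k => ζ (s k)) t))
      = coinExp (fun h => ∑ a, w a * if ζ a ≤ f h then 1 else 0) t ψ := by
  induction t generalizing ψ with
  | zero => rfl
  | succ t ih =>
    simp only [seqExp, coinExp]
    rw [← ih]
    congr 1
    ext s
    have hc : ∀ a, outcomes f (fun k => ζ (Function.update s t a k)) t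
        = outcomes f (fun k => ζ (s k)) t := fun a =>
      outcomes_congr f fun k hk => by rw [Function.update_of_ne hk.ne]
    simp only [outcomes, hc, Function.update_self]
    generalize outcomes f (fun k => ζ (s k)) t = h
    have : ∀ a, w a * ψ (decide (ζ a ≤ f h) :: h)
        = (w a * if ζ a ≤ f h then 1 else 0) * ψ (true :: h)
          + (w a - w a * if ζ a ≤ f h then 1 else 0) * ψ (false :: h) := fun a => by
      split_ifs with hh <;> simp [hh]
    simp only [this, Finset.sum_add_distrib, ← Finset.sum_mul, Finset.sum_sub_distrib, hw]

end SeqExp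

/-! ### The hard distributions -/

/-- The `j`-th point of the grid of bids that all have the same expected revenue against the
unperturbed distribution. -/
noncomputable def grid (N j : ℕ) : ℝ := j / (2 * N + j)

/-- The weights of the atoms of the distributions of the adversary's bid. -/
noncomputable def atomWeight (N : ℕ) : Fin N ⊕ Bool → ℝ :=
  Sum.elim (fun _ => 1 / (4 * N)) fun b => if b then 1 / 2 else 1 / 4

/-- The locations of the atoms of the distributions of the adversary's bid: for `i < N` the atom
at the grid point `i + 1` is moved to the grid point `i`; for `i = N` none is moved. -/
noncomputable def atomLoc (N i : ℕ) : Fin N ⊕ Bool → ℝ :=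
  Sum.elim (fun j => grid N (if (j : ℕ) = i then j else j + 1)) fun b => if b then 0 else 1

/-- The probability that the bid `x` wins. -/
noncomputable def winProb (N i : ℕ) (x : ℝ) : ℝ :=
  ∑ a, atomWeight N a * if atomLoc N i a ≤ x then 1 else 0

section Grid

variable {N : ℕ}

lemma grid_mono (hN : 0 < N) : Monotone (grid N) := by
  intro i j hij
  have : (i : ℝ) ≤ j := by exact_mod_cast hij
  have : (0 : ℝ) < N := by exact_mod_cast hN
  unfold grid
  rw [div_le_div_iff₀ (by positivity) (by positivity)]
  nlinarith

lemma grid_nonneg (j : ℕ) : 0 ≤ grid N j := by unfold grid; positivity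

lemma one_sub_grid (hN : 0 < N) (j : ℕ) : 1 - grid N j = 2 * N / (2 * N + j) := by
  have : (0 : ℝ) < N := by exact_mod_cast hN
  unfold grid
  field_simp
  ring

lemma grid_lt_one (hN : 0 < N) (j : ℕ) : grid N j < 1 := by
  have : (0 : ℝ) < N := by exact_mod_cast hN
  rw [← sub_pos, one_sub_grid hN]
  positivity

lemma atomWeight_pos (hN : 0 < N) (a : Fin N ⊕ Bool) : 0 < atomWeight N a := by
  have : (0 : ℝ) < N := by exact_mod_cast hN
  rcases a with a | a
  · simp only [atomWeight, Sum.elim_inl]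
    positivity
  · simp only [atomWeight, Sum.elim_inr]
    split_ifs <;> norm_num

lemma sum_atomWeight (hN : 0 < N) : ∑ a, atomWeight N a = 1 := by
  have : (0 : ℝ) < N := by exact_mod_cast hN
  simp only [atomWeight, Fintype.sum_sum_type, Sum.elim_inl, Sum.elim_inr, Fintype.sum_bool,
    Finset.sum_const, Finset.card_univ, Fintype.card_fin, nsmul_eq_mul]
  field_simp
  norm_num

lemma atomLoc_mem (hN : 0 < N) (i : ℕ) (a : Fin N ⊕ Bool) : atomLoc N i a ∈ Set.Icc (0 : ℝ) 1 := by
  rcases a with a | a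
  · exact ⟨grid_nonneg _, (grid_lt_one hN _).le⟩
  · simp only [atomLoc, Sum.elim_inr]
    split_ifs <;> simp

lemma winProb_nonneg (hN : 0 < N) (i : ℕ) (x : ℝ) : 0 ≤ winProb N i x :=
  Finset.sum_nonneg fun a _ => mul_nonneg (atomWeight_pos hN a).le (by split_ifs <;> norm_num)

lemma winProb_le_one (hN : 0 < N) (i : ℕ) (x : ℝ) : winProb N i x ≤ 1 := by
  rw [← sum_atomWeight hN]
  refine Finset.sum_le_sum fun a _ => ?_
  have := (atomWeight_pos hN a).le
  split_ifs <;> simp [this]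

lemma winProb_eq (i : ℕ) {x : ℝ} (h0 : 0 ≤ x) (h1 : x < 1) :
    winProb N i x = 1 / 2 + 1 / (4 * N) *
      ∑ j : Fin N, if grid N (if (j : ℕ) = i then j else j + 1) ≤ x then 1 else 0 := by
  simp only [winProb, atomWeight, atomLoc, Fintype.sum_sum_type, Sum.elim_inl, Sum.elim_inr,
    Fintype.sum_bool, ← Finset.mul_sum]
  simp only [if_true, Bool.false_eq_true, if_false, h0, not_le.2 h1, mul_one, mul_zero, add_zero]
  exact add_comm _ _

lemma winProb_perturbed {i : ℕ} (hi : i < N) (x : ℝ) :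
    winProb N i x = winProb N N x
      + 1 / (4 * N) * (Set.Ico (grid N i) (grid N (i + 1))).indicator 1 x := by
  have hN : 0 < N := by omega
  rw [← sub_eq_iff_eq_add', winProb, winProb, ← Finset.sum_sub_distrib,
    Finset.sum_eq_single (Sum.inl ⟨i, hi⟩)]
  · have hle := grid_mono hN i.le_succ
    simp only [atomWeight, atomLoc, Sum.elim_inl, if_true, hi.ne, if_false, ← mul_sub]
    congr 1
    simp only [Set.indicator_apply, Set.mem_Ico, Pi.one_apply]
    by_cases h1 : grid N i ≤ x
    · by_cases h2 : grid N (i + 1) ≤ x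
      · simp [h1, h2, not_lt.2 h2]
      · simp [h1, h2, not_le.1 h2]
    · have h2 : ¬ grid N (i + 1) ≤ x := fun h => h1 (hle.trans h)
      simp [h1, h2]
  · rintro (j | b) - hj
    · have h1 : (j : ℕ) ≠ i := fun h => hj (by simp [← h])
      simp [atomLoc, h1, j.2.ne]
    · exact sub_self _
  · simp

/-- The atom at `0` gives the lower bound. Missing the atom at `grid N (i + 1)` leaves room for the
perturbation, and the mass `1 / 4` at `1` keeps the coin away from certainty. -/
lemma winProb_unperturbed_le {i : ℕ} (hi : i < N) {x : ℝ} (h0 : 0 ≤ x)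
    (hx : x < grid N (i + 1)) :
    1 / 2 ≤ winProb N N x ∧ winProb N N x + 1 / (4 * N) ≤ 3 / 4 := by
  have hN : 0 < N := by omega
  have hN' : (0 : ℝ) < N := by exact_mod_cast hN
  rw [winProb_eq N h0 (hx.trans (grid_lt_one hN _))]
  constructor
  · have : 0 ≤ ∑ j : Fin N, if grid N (if (j : ℕ) = N then j else j + 1) ≤ x then (1 : ℝ) else 0 :=
      Finset.sum_nonneg fun _ _ => by split_ifs <;> norm_num
    have : 0 ≤ 1 / (4 * N) *
        ∑ j : Fin N, if grid N (if (j : ℕ) = N then j else j + 1) ≤ x then (1 : ℝ) else 0 := by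
      positivity
    linarith
  · have : ∑ j : Fin N, (if grid N (if (j : ℕ) = N then j else j + 1) ≤ x then (1 : ℝ) else 0)
        ≤ N - 1 := by
      have h : ∀ j : Fin N, (if grid N (if (j : ℕ) = N then j else j + 1) ≤ x then (1 : ℝ) else 0)
          ≤ 1 - if j = ⟨i, hi⟩ then 1 else 0 := fun j => by
        rcases eq_or_ne j ⟨i, hi⟩ with rfl | hj
        · simp [hi.ne, not_le.2 hx]
        · rw [if_neg hj]
          split_ifs <;> norm_num
      refine (Finset.sum_le_sum fun j _ => h j).trans_eq ?_
      rw [Finset.sum_sub_distrib]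
      simp
    have h2 := mul_le_mul_of_nonneg_left this (show 0 ≤ 1 / (4 * (N : ℝ)) by positivity)
    have h3 : 1 / (4 * (N : ℝ)) * (N - 1) = 1 / 4 - 1 / (4 * N) := by
      field_simp
    linarith

lemma revenue_unperturbed_le (hN : 0 < N) {x : ℝ} (h0 : 0 ≤ x) (h1 : x ≤ 1) :
    (1 - x) * winProb N N x ≤ 1 / 2 := by
  have hN' : (0 : ℝ) < N := by exact_mod_cast hN
  rcases h1.eq_or_lt with rfl | h1
  · norm_num
  rw [winProb_eq N h0 h1]
  -- The real solution of `y / (2 * N + y) = x`: it bounds the number of grid atoms at or below `x`,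
  -- and with it as the count the revenue is exactly `1 / 2`.
  set y : ℝ := 2 * N * x / (1 - x) with hy
  have hx : 0 < 1 - x := sub_pos.2 h1
  have hy0 : 0 ≤ y := by positivity
  have hs : ∑ j : Fin N, (if grid N (if (j : ℕ) = N then j else j + 1) ≤ x then (1 : ℝ) else 0)
      ≤ y := by
    rw [← Finset.sum_filter, Finset.sum_const, nsmul_one]
    refine le_trans ?_ (Nat.floor_le hy0)
    rw [Nat.cast_le, ← Finset.card_range ⌊y⌋₊, ← Finset.card_map Fin.valEmbedding]
    refine Finset.card_le_card fun k hk => ?_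
    obtain ⟨j, hj, rfl⟩ := Finset.mem_map.1 hk
    rw [Finset.mem_filter, if_neg j.2.ne] at hj
    rw [Finset.mem_range, Nat.lt_iff_add_one_le, Nat.le_floor_iff hy0, hy, le_div_iff₀ hx]
    have := hj.2
    rw [grid, div_le_iff₀ (by positivity)] at this
    simp only [Fin.valEmbedding_apply]
    linarith
  have h2 := mul_le_mul_of_nonneg_left hs (show 0 ≤ 1 / (4 * (N : ℝ)) by positivity)
  have h3 : (1 - x) * (1 / 2 + 1 / (4 * N) * y) = 1 / 2 := by
    rw [hy]
    field_simp
    ring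
  refine le_trans ?_ h3.le
  gcongr

/-- The `i` atoms at the points `1, …, i` already give revenue `1 / 2` at `grid N i`; the moved atom
adds the second term. -/
lemma le_revenue_grid {i : ℕ} (hi : i < N) :
    1 / 2 + (1 - grid N i) * (1 / (4 * N)) ≤ (1 - grid N i) * winProb N i (grid N i) := by
  have hN : 0 < N := by omega
  have hN' : (0 : ℝ) < N := by exact_mod_cast hN
  have hlt : grid N i < grid N (i + 1) := by
    unfold grid
    rw [div_lt_div_iff₀ (by positivity) (by positivity)]
    push_cast
    nlinarith
  rw [winProb_perturbed hi, winProb_eq N (grid_nonneg i) (grid_lt_one hN i),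
    Set.indicator_of_mem (Set.left_mem_Ico.2 hlt), Pi.one_apply, mul_one, mul_add]
  have hs : (i : ℝ) ≤ ∑ j : Fin N,
      if grid N (if (j : ℕ) = N then j else j + 1) ≤ grid N i then (1 : ℝ) else 0 := by
    rw [← Finset.sum_filter, Finset.sum_const, nsmul_one, Nat.cast_le]
    conv_lhs => rw [← Fintype.card_fin i, ← Finset.card_univ,
      ← Finset.card_map (Fin.castLEEmb hi.le)]
    refine Finset.card_le_card fun k hk => ?_
    obtain ⟨j, -, rfl⟩ := Finset.mem_map.1 hk
    have : (j : ℕ) ≠ N := by omega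
    simpa [this] using grid_mono hN j.2
  have h2 := mul_le_mul_of_nonneg_left hs (show 0 ≤ 1 / (4 * (N : ℝ)) by positivity)
  have h3 : (1 - grid N i) * (1 / 2 + 1 / (4 * N) * i) = 1 / 2 := by
    rw [one_sub_grid hN]
    field_simp
    ring
  refine add_le_add (h3.ge.trans ?_) le_rfl
  have := sub_nonneg.2 (grid_lt_one hN i).le
  gcongr

/-- The outcome histories after which the strategy `f` bids in the `i`-th cell of the grid. -/
def cell (N : ℕ) (f : List Bool → ℝ) (i : ℕ) : Set (List Bool) :=
  f ⁻¹' Set.Ico (grid N i) (grid N (i + 1))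

lemma sum_indicator_cell_le_one (hN : 0 < N) (f : List Bool → ℝ) (h : List Bool) :
    ∑ i ∈ Finset.range N, (cell N f i).indicator 1 h ≤ (1 : ℝ) := by
  by_cases hex : ∃ i ∈ Finset.range N, h ∈ cell N f i
  · obtain ⟨i, hi, hh⟩ := hex
    rw [Finset.sum_eq_single_of_mem i hi, Set.indicator_of_mem hh, Pi.one_apply]
    intro j _ hji
    refine Set.indicator_of_notMem (fun hj => ?_) _
    exact Set.disjoint_left.1 ((grid_mono hN).pairwise_disjoint_on_Ico_succ hji) hj hh
  · push Not at hex
    rw [Finset.sum_eq_zero fun i hi => Set.indicator_of_notMem (hex i hi) _]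
    exact zero_le_one

/-- Each round earns at most the unperturbed `1 / 2`, plus a bonus in the cell that is largest at
its left endpoint. -/
lemma coinExp_revenue_le {f : List Bool → ℝ} (hf : ∀ h, f h ∈ Set.Icc (0 : ℝ) 1) {i : ℕ}
    (hi : i < N) (t : ℕ) :
    coinExp (fun h => winProb N i (f h)) t (revenue f) ≤ t * (1 / 2) + (1 - grid N i) *
      (1 / (4 * N)) * coinExp (fun h => winProb N i (f h)) t (pathSum ((cell N f i).indicator 1)) := by
  have hN : 0 < N := by omega
  induction t with
  | zero => simp [coinExp, revenue, pathSum]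
  | succ t ih =>
    rw [coinExp_succ_pathSum, mul_add, ← coinExp_const_mul _ t _ ((cell N f i).indicator 1)]
    have hstep : coinExp (fun h => winProb N i (f h)) (t + 1) (revenue f)
        ≤ coinExp (fun h => winProb N i (f h)) t (fun h => revenue f h + (1 / 2 +
          (1 - grid N i) * (1 / (4 * N)) * (cell N f i).indicator 1 h)) := by
      rw [coinExp]
      refine coinExp_mono (fun h => winProb_nonneg hN _ _) (fun h => winProb_le_one hN _ _) t
        fun h _ => ?_
      have hr := revenue_unperturbed_le hN (hf h).1 (hf h).2
      have hc : (1 - f h) * (1 / (4 * N) * (cell N f i).indicator 1 h)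
          ≤ (1 - grid N i) * (1 / (4 * N)) * (cell N f i).indicator 1 h := by
        by_cases hh : h ∈ cell N f i
        · rw [Set.indicator_of_mem hh, Pi.one_apply, mul_one, mul_one]
          have := hh.1
          gcongr
        · simp [hh]
      have hp : winProb N i (f h)
          = winProb N N (f h) + 1 / (4 * N) * (cell N f i).indicator 1 h :=
        winProb_perturbed hi (f h)
      simp only [revenue]
      calc _ = revenue f h + (1 - f h) * winProb N i (f h) := by ring
        _ ≤ _ := by
          rw [hp, mul_add]
          linarith
    refine hstep.trans ?_
    rw [coinExp_add, coinExp_add, coinExp_const]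
    push_cast
    linarith

/-- Averaged over the perturbations, every strategy falls short of the best fixed bid. -/
lemma sum_coinExp_revenue_le {f : List Bool → ℝ} (hf : ∀ h, f h ∈ Set.Icc (0 : ℝ) 1)
    (hN : 8 ≤ N) {T : ℕ} (hT : 16 * T ≤ N ^ 3) :
    ∑ i ∈ Finset.range N, coinExp (fun h => winProb N i (f h)) T (revenue f)
      ≤ ∑ i ∈ Finset.range N, T * ((1 - grid N i) * winProb N i (grid N i)) - T / 12 := by
  have hN0 : 0 < N := by omega
  have hN' : (8 : ℝ) ≤ N := by exact_mod_cast hN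
  have hT' : 16 * (T : ℝ) ≤ N ^ 3 := by exact_mod_cast hT
  have hp0 : ∀ i h, 0 ≤ winProb N i (f h) := fun i h => winProb_nonneg hN0 _ _
  have hp1 : ∀ i h, winProb N i (f h) ≤ 1 := fun i h => winProb_le_one hN0 _ _
  set V : ℕ → ℝ := fun i =>
    coinExp (fun h => winProb N i (f h)) T (pathSum ((cell N f i).indicator 1)) with hV
  set U : ℕ → ℝ := fun i =>
    coinExp (fun h => winProb N N (f h)) T (pathSum ((cell N f i).indicator 1)) with hU
  have hUsum : ∑ i ∈ Finset.range N, U i ≤ T := by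
    rw [← coinExp_sum, ← coinExp_const (fun h => winProb N N (f h)) T (T : ℝ)]
    refine coinExp_mono (hp0 N) (hp1 N) T fun h hh => ?_
    rw [sum_pathSum, ← hh]
    exact pathSum_le_length (sum_indicator_cell_le_one hN0 f) h
  have hVle : ∀ i, V i ≤ T := fun i => by
    rw [← coinExp_const (fun h => winProb N i (f h)) T (T : ℝ)]
    refine coinExp_mono (hp0 i) (hp1 i) T fun h hh => ?_
    rw [← hh]
    exact pathSum_le_length (fun h => Set.indicator_le_self' (by simp) h) h
  have hVU : ∀ i ∈ Finset.range N, V i ≤ U i + T * (32 * (1 / (4 * N)) ^ 2 * U i + 1 / 4) := by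
    intro i hi
    have hi := Finset.mem_range.1 hi
    have h := coinExp_visits_le (I := cell N f i) (ε := 1 / (4 * N)) (hp0 N) (hp1 N)
      (by positivity) (fun h hh => winProb_unperturbed_le hi (hf h).1 hh.2) T
    have hq : (fun h => winProb N i (f h))
        = fun h => winProb N N (f h) + 1 / (4 * N) * (cell N f i).indicator 1 h :=
      funext fun h => winProb_perturbed hi (f h)
    rwa [← hq] at h
  have hVsum : ∑ i ∈ Finset.range N, V i ≤ N * T / 2 := by
    refine (Finset.sum_le_sum hVU).trans ?_
    rw [Finset.sum_add_distrib, ← Finset.mul_sum, Finset.sum_add_distrib, ← Finset.mul_sum]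
    simp only [Finset.sum_const, Finset.card_range, nsmul_eq_mul]
    -- The hypothesis `16 * T ≤ N ^ 3` enters here: the total information is too small for `N`
    -- alternatives.
    have h1 : 32 * (1 / (4 * (N : ℝ))) ^ 2 * ∑ i ∈ Finset.range N, U i ≤ N / 8 := by
      calc _ ≤ 32 * (1 / (4 * (N : ℝ))) ^ 2 * T := by gcongr
        _ = 16 * T / (8 * N ^ 2) := by field_simp; ring
        _ ≤ N ^ 3 / (8 * N ^ 2) := by gcongr
        _ = N / 8 := by field_simp
    have h2 := mul_le_mul_of_nonneg_left h1 (Nat.cast_nonneg (α := ℝ) T)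
    -- The sum is at most `T * (1 + N / 8 + N / 4)`, and `8 ≤ N` absorbs the `1`.
    have h3 := mul_le_mul_of_nonneg_left hN' (Nat.cast_nonneg (α := ℝ) T)
    linarith
  have hterm : ∀ i ∈ Finset.range N, coinExp (fun h => winProb N i (f h)) T (revenue f)
      ≤ T * ((1 - grid N i) * winProb N i (grid N i)) - 1 / (6 * N) * (T - V i) := by
    intro i hi
    have hi := Finset.mem_range.1 hi
    have h1 := coinExp_revenue_le hf hi T
    have h2 := mul_le_mul_of_nonneg_left (le_revenue_grid hi) (Nat.cast_nonneg (α := ℝ) T)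
    -- The grid stays below `1 / 3`, so the gain at the good bid is at least `2 / 3 * (1 / (4 * N))
    -- = 1 / (6 * N)`.
    have h3 : 2 / 3 ≤ 1 - grid N i := by
      have : (i : ℝ) ≤ N := by exact_mod_cast hi.le
      rw [one_sub_grid hN0, div_le_div_iff₀ (by norm_num) (by positivity)]
      linarith
    have h4 : 1 / (6 * (N : ℝ)) * (T - V i) ≤ (1 - grid N i) * (1 / (4 * N)) * (T - V i) := by
      refine mul_le_mul_of_nonneg_right ?_ (sub_nonneg.2 (hVle i))
      calc 1 / (6 * (N : ℝ)) = 2 / 3 * (1 / (4 * N)) := by field_simp; norm_num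
        _ ≤ _ := by gcongr
    change _ ≤ _ + _ * V i at h1
    linarith
  refine (Finset.sum_le_sum hterm).trans ?_
  rw [Finset.sum_sub_distrib, ← Finset.mul_sum _ _ (1 / (6 * (N : ℝ))), Finset.sum_sub_distrib]
  simp only [Finset.sum_const, Finset.card_range, nsmul_eq_mul]
  have h1 : 1 / (6 * (N : ℝ)) * (N * T / 2) = T / 12 := by
    field_simp
    ring
  have h2 : 1 / (6 * (N : ℝ)) * (N * T / 2) ≤ 1 / (6 * N) * (N * T - ∑ i ∈ Finset.range N, V i) := by
    gcongr
    linarith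
  linarith

end Grid

/-! ### Derandomizing the adversary -/

/-- Probabilistic method: the regret against the grid bid `i`, averaged over `i` and over random
adversary bids, is at least `T / (12 * N)`, so some perturbation and some fixed sequence attain this
value. -/
lemma exists_regret_ge {K : ℕ} [NeZero K] {Ω : Type*} [MeasurableSpace Ω] (P : Measure Ω)
    [IsProbabilityMeasure P] (A : Procedure K Ω) {N T : ℕ} (hN : 8 ≤ N) (hT : 16 * T ≤ N ^ 3) :
    ∃ β : ℕ → Fin K → ℝ, (∀ t, β t ∈ bidSpace K) ∧
      (T : ℝ) / (12 * N) ≤ A.regret P (soleBid K 1) β T := by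
  have hN0 : 0 < N := by omega
  have hN' : (0 : ℝ) < N := by exact_mod_cast hN0
  have hw := sum_atomWeight hN0
  let G : ℕ → Ω → (ℕ → Fin N ⊕ Bool) → ℝ := fun i ω s =>
    revenue (A.topBid ω) (outcomes (A.topBid ω) (fun k => atomLoc N i (s k)) T)
  let D : ℕ → (ℕ → Fin N ⊕ Bool) → ℝ := fun i s =>
    ∑ t ∈ Finset.range T, firstPriceUtility (grid N i) (atomLoc N i (s t)) - ∫ ω, G i ω s ∂P
  have hint : ∀ i, Integrable (fun ω => seqExp (atomWeight N) T (G i ω)) P ∧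
      ∫ ω, seqExp (atomWeight N) T (G i ω) ∂P
        = seqExp (atomWeight N) T fun s => ∫ ω, G i ω s ∂P := fun i =>
    integral_seqExp _ T fun s => integrable_revenue P (fun t => atomLoc_mem hN0 i (s t)) T
  have hD : ∀ i, seqExp (atomWeight N) T (D i) = T * ((1 - grid N i) * winProb N i (grid N i))
      - ∫ ω, seqExp (atomWeight N) T (G i ω) ∂P := fun i => by
    rw [seqExp_sub, seqExp_sum_range hw (fun a => firstPriceUtility (grid N i) (atomLoc N i a)),
      (hint i).2, winProb, Finset.mul_sum Finset.univ _ (1 - grid N i)]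
    congr 2
    refine Finset.sum_congr rfl fun a _ => ?_
    rw [firstPriceUtility]
    split_ifs <;> ring
  have hsum : (T : ℝ) / 12 ≤ ∑ i ∈ Finset.range N, seqExp (atomWeight N) T (D i) := by
    simp only [hD]
    rw [Finset.sum_sub_distrib, ← integral_finsetSum _ fun i _ => (hint i).1, le_sub_comm]
    -- The bound holds for each `ω` separately, since `A.topBid ω` is a deterministic strategy.
    refine (integral_mono (integrable_finsetSum _ fun i _ => (hint i).1) (integrable_const _)
      fun ω => ?_).trans_eq (b := ∫ _, _ ∂P) (by rw [integral_const, probReal_univ, one_smul])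
    refine le_trans (Finset.sum_le_sum fun i _ => le_of_eq ?_)
      (sum_coinExp_revenue_le (A.topBid_mem ω) hN hT)
    exact seqExp_outcomes hw (atomLoc N i) (A.topBid ω) T (revenue (A.topBid ω))
  obtain ⟨i, -, hi⟩ := Finset.exists_le_of_sum_le (s := Finset.range N)
    (f := fun _ => (T : ℝ) / (12 * N)) ⟨0, Finset.mem_range.2 hN0⟩ (by
      refine le_trans (le_of_eq ?_) hsum
      rw [Finset.sum_const, Finset.card_range, nsmul_eq_mul]
      field_simp)
  obtain ⟨s, hs⟩ := exists_seqExp_le (atomWeight_pos hN0) hw T (D i)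
  have hz := fun t => atomLoc_mem hN0 i (s t)
  exact ⟨fun t => singleUnitBid K (atomLoc N i (s t)), fun t => singleUnitBid_mem (hz t),
    (hi.trans hs).trans (regret_ge P hz T ⟨grid_nonneg i, (grid_lt_one hN0 i).le⟩)⟩

end UniformAuction

theorem mainTheorem3 :
    ∃ c : ℝ, 0 < c ∧
      ∀ (K : ℕ) [NeZero K],
        ∃ v : Fin K → ℝ, Antitone v ∧ (∀ k, v k ∈ Set.Icc (0 : ℝ) 1) ∧
          ∀ (T : ℕ), 1 ≤ T →
            ∀ (Ω : Type*) [MeasurableSpace Ω] (P : MeasureTheory.Measure Ω)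
              [MeasureTheory.IsProbabilityMeasure P] (A : UniformAuction.Procedure K Ω),
              ∃ β : ℕ → Fin K → ℝ, (∀ t, β t ∈ UniformAuction.bidSpace K) ∧
                c * (T : ℝ) ^ (2 / 3 : ℝ) ≤ A.regret P v β T := by
  refine ⟨1 / 108, by norm_num, fun K _ => ⟨UniformAuction.soleBid K 1,
    (UniformAuction.soleBid_mem (by simp)).1, (UniformAuction.soleBid_mem (by simp)).2,
    fun T hT Ω _ P _ A => ?_⟩⟩
  have hT1 : (1 : ℝ) ≤ T := by exact_mod_cast hT
  have hT0 : (0 : ℝ) ≤ T := by linarith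
  set r : ℝ := (T : ℝ) ^ (1 / 3 : ℝ) with hr
  have hr1 : 1 ≤ r := Real.one_le_rpow hT1 (by norm_num)
  have hr3 : r ^ 3 = T := by
    rw [hr, ← Real.rpow_natCast, ← Real.rpow_mul hT0]
    norm_num
  have hr2 : (T : ℝ) ^ (2 / 3 : ℝ) = r ^ 2 := by
    rw [hr, ← Real.rpow_natCast, ← Real.rpow_mul hT0]
    norm_num
  -- The choice `N = ⌈8 * r⌉₊` gives `8 ≤ N` because `r ≥ 1`, and `N ≤ 9 * r` turns `T / (12 * N)`
  -- into at least `r ^ 2 / 108`.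
  have hNlow : 8 * r ≤ ⌈8 * r⌉₊ := Nat.le_ceil _
  have hNup : (⌈8 * r⌉₊ : ℝ) ≤ 9 * r := by
    have := Nat.ceil_lt_add_one (show 0 ≤ 8 * r by positivity)
    linarith
  have hN8 : 8 ≤ ⌈8 * r⌉₊ := by
    have : (8 : ℝ) ≤ ⌈8 * r⌉₊ := by linarith
    exact_mod_cast this
  have hN3 : 16 * T ≤ ⌈8 * r⌉₊ ^ 3 := by
    have h : (8 * r) ^ 3 ≤ (⌈8 * r⌉₊ : ℝ) ^ 3 := by gcongr
    have : 16 * (T : ℝ) ≤ (⌈8 * r⌉₊ : ℝ) ^ 3 := by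
      rw [mul_pow, hr3] at h
      linarith
    exact_mod_cast this
  obtain ⟨β, hβ, hreg⟩ := UniformAuction.exists_regret_ge P A hN8 hN3
  refine ⟨β, hβ, le_trans ?_ hreg⟩
  rw [hr2, ← hr3, le_div_iff₀ (by linarith)]
  calc 1 / 108 * r ^ 2 * (12 * (⌈8 * r⌉₊ : ℝ)) ≤ 1 / 108 * r ^ 2 * (12 * (9 * r)) := by gcongr
    _ = r ^ 3 := by ring
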